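/- For a complex-valued $2\pi$-periodic function $f$ on $\mathbb{R}$, integrable over a period, let $\|f\|_1=\int_{-\pi}^{\pi}|f(x)|\,dx$, $\hat f(k)=\frac1{2\pi}\int_{-\pi}^{\pi}f(x)e^{-ikx}\,dx$ for $k\in\mathbb{Z}$, and $S_n(f)(x)=\sum_{k=-n}^{n}\hat f(k)e^{ikx}$. A complex sequence $\{c_n\}$ belongs to the class GBV if (i) there is $\theta\in[0,\pi/2)$ such that $c_n\in\{z\in\mathbb{C}:|\arg z|\le\theta\}\cup\{0\}$ for all $n\ge1$, and (ii) there are an integer $N_0\ge1$ and a constant $M>0$ such that $$\sum_{n=m}^{2m}|c_n-c_{n+1}|\le M\max_{m\le n<m+N_0}|c_n|\qquad\text{for all } m=1,2,\dots$$ (no condition is imposed on $c_0$). **Corollary 2.** Let $f$ be a real-valued $2\pi$-periodic function, integrable over a period, such that $\{\hat f(n)\}_{n\ge0}$ belongs to GBV. Then $$\lim_{n\to\infty}\|f-S_n(f)\|_1=0\quad\text{if and only if}\quad\lim_{n\to\infty}\hat f(n)\log|n|=0,$$ and this holds both when the second limit is taken as $n\to+\infty$ and when it is taken as $|n|\to\infty$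 over $n\in\mathbb{Z}$. -/

import Mathlib

noncomputable section

/-- `f` is a complex valued function of period `2π` that is integrable over a period. -/
def MemL2pi (f : ℝ → ℂ) : Prop :=
  Function.Periodic f (2 * Real.pi) ∧
    IntervalIntegrable f MeasureTheory.volume (-Real.pi) Real.pi

/-- The norm `∫_{-π}^{π} |f(x)| dx`. -/
def l1Norm (f : ℝ → ℂ) : ℝ :=
  ∫ x in (-Real.pi)..Real.pi, ‖f x‖

/-- The Fourier coefficient `(1 / 2π) ∫_{-π}^{π} f(x) e^{-ikx} dx`. -/
def fourierHat (f : ℝ → ℂ) (k : ℤ) : ℂ :=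
  fourierCoeffOn (neg_lt_self Real.pi_pos) f k

/-- The `n`th symmetric partial sum of the Fourier series of `f`. -/
def fourierPartialSum (f : ℝ → ℂ) (n : ℕ) (x : ℝ) : ℂ :=
  ∑ k ∈ Finset.Icc (-(n : ℤ)) (n : ℤ), fourierHat f k * Complex.exp (Complex.I * k * x)

/-- The sector `{z : |arg z| ≤ θ}`; since `Complex.arg 0 = 0` it contains `0` for `0 ≤ θ`. -/
def sector (θ : ℝ) : Set ℂ :=
  {z | |Complex.arg z| ≤ θ}

/-- The class GBV. Only the terms `c n` with `1 ≤ n` are constrained. -/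
def IsGBV (c : ℕ → ℂ) : Prop :=
  (∃ θ : ℝ, 0 ≤ θ ∧ θ < Real.pi / 2 ∧ ∀ n : ℕ, 1 ≤ n → c n ∈ sector θ) ∧
  ∃ (N : ℕ) (hN : 1 ≤ N) (M : ℝ), 0 < M ∧ ∀ m : ℕ, 1 ≤ m →
    ∑ n ∈ Finset.Icc m (2 * m), ‖c n - c (n + 1)‖ ≤
      M * (Finset.Ico m (m + N)).sup' (Finset.nonempty_Ico.mpr (Nat.lt_add_of_pos_right hN))
        (fun n => ‖c n‖)

end

/-!
If `f̂(n) log |n| → 0`: the de la Vallée Poussin means of `f` converge to `f` in `L¹`, because they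
are differences of Fejér means and trigonometric polynomials are dense. By Abel's inequality
`‖S_l f - S_n f‖₁`, for `n ≤ l < 2n`, is at most a multiple of `log n` times the variation of the
coefficients over that block. The GBV condition bounds the variation by a single coefficient, so
`S_n f` is asymptotically as good as the mean.

Conversely, the sums `∑_{j ≤ n} sin (j x) / j` are uniformly bounded. Pairing them with
`(f - S_n f) e^{-inx}`, whose coefficients vanish at the frequencies `-n, …, 0`, bounds
`|∑_{1 ≤ j ≤ n} f̂(n + j) / j|` by a multiple of `‖f - S_n f‖₁`. The sector condition lets the
moduli replace the coefficients, and GBV bounds `|f̂(p)|` by a multiple of the sum of the moduli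
over any window of fixed length between `p / 2` and `p`, so that with `n = p / 2` the weighted sum
dominates `|f̂(p)| log p`.
-/

open Filter MeasureTheory
open Complex (I exp)
open scoped ComplexConjugate Real Topology

theorem sum_Icc_neg_eq_add_sum_Ico {M : Type*} [AddCommMonoid M] (g : ℤ → M) {m n : ℕ}
    (hmn : m ≤ n) :
    ∑ k ∈ Finset.Icc (-(n : ℤ)) n, g k =
      ∑ k ∈ Finset.Icc (-(m : ℤ)) m, g k + ∑ k ∈ Finset.Ico (m + 1) (n + 1), (g k + g (-k)) := by
  induction n, hmn using Nat.le_induction with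
  | base => simp
  | succ n hmn ih =>
    have hIcc : Finset.Icc (-((n + 1 : ℕ) : ℤ)) (n + 1 : ℕ) =
        insert ((n + 1 : ℕ) : ℤ) (insert (-((n + 1 : ℕ) : ℤ)) (Finset.Icc (-(n : ℤ)) n)) := by
      grind
    rw [hIcc, Finset.sum_insert (by grind), Finset.sum_insert (by grind), ih,
      Finset.sum_Ico_succ_top (by omega : m + 1 ≤ n + 1)]
    push_cast
    abel

theorem sum_sum_add_div_le {a : ℕ → ℝ} (ha : ∀ l, 0 ≤ a l) (N J : ℕ) :
    ∑ j ∈ Finset.Ico 1 (J + 1), (∑ i ∈ Finset.range N, a (j + i)) / j ≤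
      N ^ 2 * ∑ l ∈ Finset.Ico 1 (J + N), a l / l := by
  have hshift : ∀ i ∈ Finset.range N, ∑ j ∈ Finset.Ico 1 (J + 1), a (j + i) / j ≤
      N * ∑ l ∈ Finset.Ico 1 (J + N), a l / l := by
    intro i hi
    have hi : i < N := Finset.mem_range.1 hi
    calc ∑ j ∈ Finset.Ico 1 (J + 1), a (j + i) / j
        ≤ ∑ j ∈ Finset.Ico 1 (J + 1), N * (a (j + i) / (j + i : ℕ)) := by
          refine Finset.sum_le_sum fun j hj => ?_
          have hj : 1 ≤ j := (Finset.mem_Ico.1 hj).1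
          have hj0 : (0 : ℝ) < j := by exact_mod_cast hj
          have hji : ((j + i : ℕ) : ℝ) ≤ N * j := by exact_mod_cast (by nlinarith : j + i ≤ N * j)
          rw [← mul_div_assoc, div_le_div_iff₀ hj0 (by positivity)]
          nlinarith [ha (j + i)]
      _ = N * ∑ l ∈ Finset.Ico (1 + i) (J + 1 + i), a l / l := by
          rw [← Finset.mul_sum, Finset.sum_Ico_add' (fun l : ℕ => a l / l)]
      _ ≤ N * ∑ l ∈ Finset.Ico 1 (J + N), a l / l := by
          refine mul_le_mul_of_nonneg_left (Finset.sum_le_sum_of_subset_of_nonneg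
            (Finset.Ico_subset_Ico (by omega) (by omega)) fun l _ _ => ?_) N.cast_nonneg
          exact div_nonneg (ha l) l.cast_nonneg
  calc ∑ j ∈ Finset.Ico 1 (J + 1), (∑ i ∈ Finset.range N, a (j + i)) / j
      = ∑ i ∈ Finset.range N, ∑ j ∈ Finset.Ico 1 (J + 1), a (j + i) / j := by
        simp only [Finset.sum_div]
        exact Finset.sum_comm
    _ ≤ ∑ _i ∈ Finset.range N, N * ∑ l ∈ Finset.Ico 1 (J + N), a l / l :=
        Finset.sum_le_sum hshift
    _ = N ^ 2 * ∑ l ∈ Finset.Ico 1 (J + N), a l / l := by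
        rw [Finset.sum_const, Finset.card_range, nsmul_eq_mul]
        ring

/-- The norm of bounded variation of the block `c m, …, c n`, anchored at its last term: it is the
constant in Abel's inequality. -/
def bvNorm {E : Type*} [SeminormedAddCommGroup E] (c : ℕ → E) (m n : ℕ) : ℝ :=
  ‖c n‖ + ∑ k ∈ Finset.Ico m n, ‖c k - c (k + 1)‖

theorem bvNorm_eq_of_antitoneOn {c : ℕ → ℝ} {m n : ℕ} (hmn : m ≤ n)
    (hc : AntitoneOn c (Set.Icc m n)) (hn : 0 ≤ c n) : bvNorm c m n = c m := by
  have hvar : ∀ k ∈ Finset.Ico m n, ‖c k - c (k + 1)‖ = -(c (k + 1) - c k) := by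
    intro k hk
    rw [Finset.mem_Ico] at hk
    rw [Real.norm_of_nonneg, neg_sub]
    exact sub_nonneg.2 (hc ⟨hk.1, hk.2.le⟩ ⟨by omega, hk.2⟩ k.le_succ)
  rw [bvNorm, Finset.sum_congr rfl hvar, Finset.sum_neg_distrib, Finset.sum_Ico_sub c hmn,
    Real.norm_of_nonneg hn]
  ring

theorem sum_Ico_mul_eq_by_parts {R : Type*} [Ring R] (a v : ℕ → R) {m n : ℕ} (hmn : m ≤ n) :
    ∑ k ∈ Finset.Ico m n, a k * v k = a n * ∑ k ∈ Finset.Ico m n, v k +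
      ∑ k ∈ Finset.Ico m n, (a k - a (k + 1)) * ∑ i ∈ Finset.Ico m (k + 1), v i := by
  induction n, hmn using Nat.le_induction with
  | base => simp
  | succ n hmn ih =>
    rw [Finset.sum_Ico_succ_top hmn, ih, Finset.sum_Ico_succ_top hmn (fun k => _ * _),
      Finset.sum_Ico_succ_top hmn]
    noncomm_ring

theorem norm_sum_Ico_mul_le_bvNorm_mul {R : Type*} [SeminormedRing R] {a v : ℕ → R} {m n : ℕ}
    (hmn : m ≤ n) {B : ℝ} (hB : ∀ l ≤ n, ‖∑ k ∈ Finset.Ico m l, v k‖ ≤ B) :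
    ‖∑ k ∈ Finset.Ico m n, a k * v k‖ ≤ bvNorm a m n * B := by
  rw [sum_Ico_mul_eq_by_parts a v hmn, bvNorm, add_mul, Finset.sum_mul]
  refine norm_add_le_of_le ?_ (norm_sum_le_of_le _ fun k hk => ?_)
  · exact norm_mul_le_of_le le_rfl (hB n le_rfl)
  · exact norm_mul_le_of_le le_rfl (hB (k + 1) (Finset.mem_Ico.1 hk).2)

theorem exp_I_mul_int_mul (k : ℤ) (x : ℝ) : exp (I * k * x) = exp (I * x) ^ k := by
  rw [← Complex.exp_int_mul]
  ring_nf

theorem two_div_pi_mul_abs_le_norm_exp_sub_one {x : ℝ} (hx : |x| ≤ π) :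
    2 / π * |x| ≤ ‖exp (I * x) - 1‖ := by
  have h := Real.mul_abs_le_abs_sin (x := x / 2) (by rw [abs_div, abs_two]; linarith)
  rw [abs_div, abs_two] at h
  rw [Complex.norm_exp_I_mul_ofReal_sub_one, norm_mul, Real.norm_ofNat, Real.norm_eq_abs]
  linarith

theorem norm_geom_sum_Ico_mul_norm_sub_one_le {z : ℂ} (hz : ‖z‖ = 1) (m n : ℕ) :
    ‖∑ k ∈ Finset.Ico m n, z ^ k‖ * ‖z - 1‖ ≤ 2 := by
  rcases le_total n m with hnm | hmn
  · simp [Finset.Ico_eq_empty_of_le hnm]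
  · calc ‖∑ k ∈ Finset.Ico m n, z ^ k‖ * ‖z - 1‖ = ‖z ^ n - z ^ m‖ := by
          rw [← norm_mul, geom_sum_Ico_mul _ hmn]
      _ ≤ ‖z ^ n‖ + ‖z ^ m‖ := norm_sub_le _ _
      _ = 2 := by simp only [norm_pow, hz, one_pow]; norm_num

theorem norm_geom_sum_exp_mul_abs_le {x : ℝ} (hx : |x| ≤ π) (m n : ℕ) :
    ‖∑ k ∈ Finset.Ico m n, exp (I * x) ^ k‖ * |x| ≤ π := by
  have hgeom := norm_geom_sum_Ico_mul_norm_sub_one_le (Complex.norm_exp_I_mul_ofReal x) m n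
  set A := ‖∑ k ∈ Finset.Ico m n, exp (I * x) ^ k‖
  calc A * |x| = A * (2 / π * |x|) * (π / 2) := by field_simp
    _ ≤ A * ‖exp (I * x) - 1‖ * (π / 2) := by
        gcongr
        exact two_div_pi_mul_abs_le_norm_exp_sub_one hx
    _ ≤ 2 * (π / 2) := by gcongr
    _ = π := by ring

theorem norm_geom_sum_exp_le (x : ℝ) (m n : ℕ) :
    ‖∑ k ∈ Finset.Ico m n, exp (I * x) ^ k‖ ≤ (n - m : ℕ) := by
  refine (norm_sum_le _ _).trans ?_
  simp [Complex.norm_exp_I_mul_ofReal]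

/-- The harmonic mean of the two bounds `N` and `π / |x|` for a geometric sum of at most `N` powers
of `e^{ix}`. Its integral over a period is explicit and of order `log N`. -/
noncomputable def geomSumMajorant (N : ℕ) (x : ℝ) : ℝ :=
  2 * π * N / (N * |x| + π)

theorem norm_geom_sum_exp_le_geomSumMajorant {x : ℝ} (hx : |x| ≤ π) {m n N : ℕ} (h : n - m ≤ N) :
    ‖∑ k ∈ Finset.Ico m n, exp (I * x) ^ k‖ ≤ geomSumMajorant N x := by
  have hdecay := norm_geom_sum_exp_mul_abs_le hx m n
  have hcard : ‖∑ k ∈ Finset.Ico m n, exp (I * x) ^ k‖ ≤ N :=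
    (norm_geom_sum_exp_le x m n).trans (by exact_mod_cast h)
  rw [geomSumMajorant, le_div_iff₀ (by positivity)]
  nlinarith [mul_le_mul_of_nonneg_left hdecay N.cast_nonneg, Real.pi_pos]

theorem geomSumMajorant_neg (N : ℕ) (x : ℝ) : geomSumMajorant N (-x) = geomSumMajorant N x := by
  rw [geomSumMajorant, geomSumMajorant, abs_neg]

theorem continuous_geomSumMajorant (N : ℕ) : Continuous (geomSumMajorant N) :=
  Continuous.div (by fun_prop) (by fun_prop) fun x => by positivity

theorem integral_geomSumMajorant_zero_pi (N : ℕ) :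
    ∫ x in (0 : ℝ)..π, geomSumMajorant N x = 2 * π * Real.log (N + 1) := by
  have hderiv : ∀ x ∈ Set.uIcc 0 π,
      HasDerivAt (fun x => 2 * π * Real.log (N * x + π)) (geomSumMajorant N x) x := by
    intro x hx
    rw [Set.uIcc_of_le Real.pi_pos.le] at hx
    have hne : (N : ℝ) * x + π ≠ 0 := by have := hx.1; positivity
    refine (((((hasDerivAt_id' x).const_mul (N : ℝ)).add_const π).log hne).const_mul
      (2 * π)).congr_deriv ?_
    rw [geomSumMajorant, abs_of_nonneg hx.1]
    ring
  rw [intervalIntegral.integral_eq_sub_of_hasDerivAt hderiv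
      ((continuous_geomSumMajorant N).intervalIntegrable _ _),
    show (N : ℝ) * π + π = (N + 1) * π by ring, Real.log_mul (by positivity) Real.pi_ne_zero]
  ring_nf

theorem integral_geomSumMajorant (N : ℕ) :
    ∫ x in (-π)..π, geomSumMajorant N x = 4 * π * Real.log (N + 1) := by
  have hint (a b : ℝ) : IntervalIntegrable (geomSumMajorant N) volume a b :=
    (continuous_geomSumMajorant N).intervalIntegrable a b
  have hneg : ∫ x in (-π)..0, geomSumMajorant N x = ∫ x in (0 : ℝ)..π, geomSumMajorant N x := by
    simpa only [geomSumMajorant_neg, neg_zero] using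
      (intervalIntegral.integral_comp_neg (a := 0) (b := π) (geomSumMajorant N)).symm
  rw [← intervalIntegral.integral_add_adjacent_intervals (hint (-π) 0) (hint 0 π), hneg,
    integral_geomSumMajorant_zero_pi]
  ring

theorem abs_sum_sin_le_norm_geom_sum_exp (x : ℝ) (m n : ℕ) :
    |∑ j ∈ Finset.Ico m n, Real.sin (j * x)| ≤ ‖∑ j ∈ Finset.Ico m n, exp (I * x) ^ j‖ := by
  have him : (∑ j ∈ Finset.Ico m n, exp (I * x) ^ j).im =
      ∑ j ∈ Finset.Ico m n, Real.sin (j * x) := by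
    rw [Complex.im_sum]
    refine Finset.sum_congr rfl fun j _ => ?_
    rw [← Complex.exp_nat_mul, ← Complex.exp_ofReal_mul_I_im]
    push_cast
    ring_nf
  rw [← him]
  exact Complex.abs_im_le_norm _

theorem abs_sum_sin_div_le_mul_abs (x : ℝ) (n : ℕ) :
    |∑ j ∈ Finset.Ico 1 (n + 1), Real.sin (j * x) / j| ≤ n * |x| := by
  have hterm : ∀ j ∈ Finset.Ico 1 (n + 1), |Real.sin (j * x) / j| ≤ |x| := by
    intro j hj
    have hj : (0 : ℝ) < j := by exact_mod_cast (Finset.mem_Ico.1 hj).1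
    rw [abs_div, Nat.abs_cast, div_le_iff₀ hj]
    exact Real.abs_sin_le_abs.trans_eq (by rw [abs_mul, Nat.abs_cast, mul_comm])
  refine (Finset.abs_sum_le_sum_abs _ _).trans ((Finset.sum_le_card_nsmul _ _ _ hterm).trans ?_)
  simp

theorem abs_sum_Ico_sin_div_mul_le {x : ℝ} (hx : |x| ≤ π) {m n : ℕ} (hm : 1 ≤ m) (hmn : m ≤ n) :
    |∑ j ∈ Finset.Ico m n, Real.sin (j * x) / j| * (m * |x|) ≤ π := by
  have : (0 : ℝ) < m := by exact_mod_cast hm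
  rcases eq_or_ne x 0 with rfl | hx0
  · simp [Real.pi_pos.le]
  have hx0 : 0 < |x| := abs_pos.2 hx0
  have hanti : AntitoneOn (fun j : ℕ => (j : ℝ)⁻¹) (Set.Icc m n) := fun j hj k _ hjk =>
    inv_anti₀ (by exact_mod_cast hm.trans hj.1) (by exact_mod_cast hjk)
  have hsin : ∀ l ≤ n, ‖∑ j ∈ Finset.Ico m l, Real.sin (j * x)‖ ≤ π / |x| := fun l _ => by
    rw [le_div_iff₀ hx0]
    exact (mul_le_mul_of_nonneg_right (abs_sum_sin_le_norm_geom_sum_exp x m l) hx0.le).trans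
      (norm_geom_sum_exp_mul_abs_le hx m l)
  have habel := norm_sum_Ico_mul_le_bvNorm_mul (a := fun j : ℕ => (j : ℝ)⁻¹) hmn hsin
  rw [bvNorm_eq_of_antitoneOn hmn hanti (by positivity), ← div_eq_inv_mul, div_div] at habel
  rw [← le_div_iff₀ (by positivity), mul_comm (m : ℝ)]
  simpa only [Real.norm_eq_abs, div_eq_inv_mul] using habel

-- Split at `1 / |x|`: below it use `|sin (j x)| ≤ j |x|`, above it Abel's inequality.
theorem abs_sum_sin_div_le {x : ℝ} (hx : |x| ≤ π) (n : ℕ) :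
    |∑ j ∈ Finset.Ico 1 (n + 1), Real.sin (j * x) / j| ≤ 1 + π := by
  rcases eq_or_ne x 0 with rfl | hx0
  · simpa using add_nonneg zero_le_one Real.pi_pos.le
  have hx0 : 0 < |x| := abs_pos.2 hx0
  set K := ⌊1 / |x|⌋₊
  have hK : K * |x| ≤ 1 := (le_div_iff₀ hx0).1 (Nat.floor_le (by positivity))
  have hK' : 1 < (K + 1 : ℕ) * |x| := by
    exact_mod_cast (div_lt_iff₀ hx0).1 (Nat.lt_floor_add_one (1 / |x|))
  rcases le_total n K with hn | hn
  · have hnK : n * |x| ≤ K * |x| := by gcongr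
    linarith [abs_sum_sin_div_le_mul_abs x n, Real.pi_pos]
  · have htail := abs_sum_Ico_sin_div_mul_le hx (Nat.le_add_left 1 K) (Nat.succ_le_succ hn)
    rw [← Finset.sum_Ico_consecutive _ (Nat.le_add_left 1 K) (Nat.succ_le_succ hn)]
    refine (abs_add_le _ _).trans
      (add_le_add ((abs_sum_sin_div_le_mul_abs x K).trans hK) (le_trans ?_ htail))
    exact le_mul_of_one_le_right (abs_nonneg _) hK'.le

theorem l1Norm_nonneg (f : ℝ → ℂ) : 0 ≤ l1Norm f :=
  intervalIntegral.integral_nonneg (by linarith [Real.pi_pos]) fun _ _ => norm_nonneg _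

theorem l1Norm_const_mul (c : ℂ) (f : ℝ → ℂ) : l1Norm (fun x => c * f x) = ‖c‖ * l1Norm f := by
  simp only [l1Norm, norm_mul, intervalIntegral.integral_const_mul]

theorem l1Norm_comp_neg (f : ℝ → ℂ) : l1Norm (fun x => f (-x)) = l1Norm f := by
  rw [l1Norm, intervalIntegral.integral_comp_neg fun x => ‖f x‖, neg_neg, l1Norm]

theorem l1Norm_add_le {f g : ℝ → ℂ} (hf : IntervalIntegrable f volume (-π) π)
    (hg : IntervalIntegrable g volume (-π) π) :
    l1Norm (fun x => f x + g x) ≤ l1Norm f + l1Norm g := by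
  rw [l1Norm, l1Norm, l1Norm, ← intervalIntegral.integral_add hf.norm hg.norm]
  exact intervalIntegral.integral_mono_on (by linarith [Real.pi_pos]) (hf.add hg).norm
    (hf.norm.add hg.norm) fun x _ => norm_add_le _ _

theorem l1Norm_sub_le {f g : ℝ → ℂ} (hf : IntervalIntegrable f volume (-π) π)
    (hg : IntervalIntegrable g volume (-π) π) :
    l1Norm (fun x => f x - g x) ≤ l1Norm f + l1Norm g := by
  rw [l1Norm, l1Norm, l1Norm, ← intervalIntegral.integral_add hf.norm hg.norm]
  exact intervalIntegral.integral_mono_on (by linarith [Real.pi_pos]) (hf.sub hg).norm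
    (hf.norm.add hg.norm) fun x _ => norm_sub_le _ _

theorem l1Norm_sum_le {ι : Type*} (s : Finset ι) {f : ι → ℝ → ℂ}
    (hf : ∀ i ∈ s, IntervalIntegrable (f i) volume (-π) π) :
    l1Norm (fun x => ∑ i ∈ s, f i x) ≤ ∑ i ∈ s, l1Norm (f i) := by
  have hsum : IntervalIntegrable (fun x => ∑ i ∈ s, f i x) volume (-π) π := by
    simpa only [Finset.sum_fn] using IntervalIntegrable.sum s hf
  have hnorm : IntervalIntegrable (fun x => ∑ i ∈ s, ‖f i x‖) volume (-π) π := by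
    simpa only [Finset.sum_fn] using IntervalIntegrable.sum s fun i hi => (hf i hi).norm
  simp only [l1Norm]
  rw [← intervalIntegral.integral_finsetSum fun i hi => (hf i hi).norm]
  exact intervalIntegral.integral_mono_on (by linarith [Real.pi_pos]) hsum.norm hnorm
    fun x _ => norm_sum_le _ _

theorem l1Norm_integral_mul_comp_sub_le {f K : ℝ → ℂ} (hf : IntervalIntegrable f volume (-π) π)
    (hK : Continuous K) (hper : Function.Periodic K (2 * π)) :
    l1Norm (fun x => ∫ t in (-π)..π, f t * K (x - t)) ≤ l1Norm f * l1Norm K := by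
  have hπ : -π ≤ π := by linarith [Real.pi_pos]
  set μ := (volume : Measure ℝ).restrict (Set.Ioc (-π) π) with hμ
  obtain ⟨B, hB⟩ := (hper.isBounded_of_continuous Real.two_pi_pos.ne' hK).exists_norm_le
  have hint : Integrable (Function.uncurry fun x t : ℝ => ‖f t‖ * ‖K (x - t)‖) (μ.prod μ) := by
    refine ((hf.1.norm.comp_snd μ).mul_bdd (c := B) ?_ (.of_forall fun p => ?_))
    · exact (hK.norm.comp (continuous_fst.sub continuous_snd)).aestronglyMeasurable
    · rw [norm_norm]
      exact hB _ ⟨_, rfl⟩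
  have htranslate (t : ℝ) : ∫ x in (-π)..π, ‖K (x - t)‖ = l1Norm K := by
    have h := (hper.comp (‖·‖)).intervalIntegral_add_eq (-π - t) (-π)
    rw [show -π - t + 2 * π = π - t by ring, show -π + 2 * π = π by ring] at h
    rw [intervalIntegral.integral_comp_sub_right fun x => ‖K x‖]
    exact h
  simp only [l1Norm, intervalIntegral.integral_of_le hπ, ← hμ] at htranslate ⊢
  calc ∫ x, ‖∫ t, f t * K (x - t) ∂μ‖ ∂μ
      ≤ ∫ x, ∫ t, ‖f t‖ * ‖K (x - t)‖ ∂μ ∂μ := by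
        refine integral_mono_of_nonneg (.of_forall fun _ => norm_nonneg _)
          hint.integral_prod_left (.of_forall fun x => ?_)
        exact (norm_integral_le_integral_norm _).trans_eq (by simp only [norm_mul])
    _ = ∫ t, ∫ x, ‖f t‖ * ‖K (x - t)‖ ∂μ ∂μ := integral_integral_swap hint
    _ = (∫ t, ‖f t‖ ∂μ) * ∫ x, ‖K x‖ ∂μ := by
        simp only [integral_const_mul, htranslate, integral_mul_const]

theorem fourierHat_eq_integral (f : ℝ → ℂ) (k : ℤ) :
    fourierHat f k = (2 * π : ℂ)⁻¹ * ∫ t in (-π)..π, f t * exp (-(I * k * t)) := by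
  rw [fourierHat, fourierCoeffOn_eq_integral, Complex.real_smul]
  congr 1
  · push_cast
    ring
  · refine intervalIntegral.integral_congr fun t _ => ?_
    have hπ : (π : ℂ) ≠ 0 := by exact_mod_cast Real.pi_ne_zero
    simp only [fourier_coe_apply, smul_eq_mul]
    rw [mul_comm]
    congr 2
    push_cast
    field_simp
    ring

theorem fourierHat_sub {f g : ℝ → ℂ} (hf : IntervalIntegrable f volume (-π) π)
    (hg : IntervalIntegrable g volume (-π) π) (k : ℤ) :
    fourierHat (fun x => f x - g x) k = fourierHat f k - fourierHat g k := by
  simp only [fourierHat_eq_integral, sub_mul]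
  rw [intervalIntegral.integral_sub (hf.mul_continuousOn (by fun_prop))
    (hg.mul_continuousOn (by fun_prop)), mul_sub]

theorem fourierHat_ofReal_neg (f : ℝ → ℝ) (k : ℤ) :
    fourierHat (fun x => (f x : ℂ)) (-k) = conj (fourierHat (fun x => (f x : ℂ)) k) := by
  simp only [fourierHat_eq_integral, map_mul, map_inv₀, ← intervalIntegral.intervalIntegral_conj]
  simp [← Complex.exp_conj, Complex.conj_ofNat]

theorem fourierHat_comp_neg (f : ℝ → ℂ) (k : ℤ) :
    fourierHat (fun x => f (-x)) k = fourierHat f (-k) := by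
  rw [fourierHat_eq_integral, fourierHat_eq_integral, ← neg_neg π,
    ← intervalIntegral.integral_comp_neg, neg_neg]
  simp

theorem fourierHat_mul_exp (f : ℝ → ℂ) (n k : ℤ) :
    fourierHat (fun x => f x * exp (-(I * n * x))) k = fourierHat f (n + k) := by
  simp only [fourierHat_eq_integral, mul_assoc (f _), ← Complex.exp_add, Int.cast_add, mul_add,
    add_mul, neg_add]

theorem integral_exp_I_mul_int_mul (k : ℤ) :
    ∫ x in (-π)..π, exp (I * k * x) = if k = 0 then (2 * π : ℂ) else 0 := by
  split_ifs with hk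
  · simp [hk, two_mul]
  · have hne : I * k ≠ 0 := mul_ne_zero Complex.I_ne_zero (by exact_mod_cast hk)
    rw [integral_exp_mul_complex hne, div_eq_zero_iff, sub_eq_zero,
      Complex.exp_eq_exp_iff_exists_int]
    exact .inl ⟨k, by push_cast; ring⟩

/-- The trigonometric polynomial with coefficients `c` and frequencies in `s`. -/
noncomputable def trigPoly (s : Finset ℤ) (c : ℤ → ℂ) (x : ℝ) : ℂ :=
  ∑ k ∈ s, c k * exp (I * k * x)

theorem continuous_trigPoly (s : Finset ℤ) (c : ℤ → ℂ) : Continuous (trigPoly s c) := by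
  unfold trigPoly
  fun_prop

theorem periodic_trigPoly (s : Finset ℤ) (c : ℤ → ℂ) :
    Function.Periodic (trigPoly s c) (2 * π) := by
  refine fun x => Finset.sum_congr rfl fun k _ => ?_
  congr 1
  rw [Complex.exp_eq_exp_iff_exists_int]
  exact ⟨k, by push_cast; ring⟩

theorem fourierHat_trigPoly (s : Finset ℤ) (c : ℤ → ℂ) (k : ℤ) :
    fourierHat (trigPoly s c) k = if k ∈ s then c k else 0 := by
  have : (2 * π : ℂ) ≠ 0 := by exact_mod_cast Real.two_pi_pos.ne'
  have hexp (j : ℤ) (t : ℝ) :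
      c j * exp (I * j * t) * exp (-(I * k * t)) = c j * exp (I * (j - k : ℤ) * t) := by
    rw [mul_assoc, ← Complex.exp_add]
    push_cast
    ring_nf
  simp only [fourierHat_eq_integral, trigPoly, Finset.sum_mul, hexp]
  rw [intervalIntegral.integral_finsetSum
    fun j _ => Continuous.intervalIntegrable (by fun_prop) _ _]
  simp only [intervalIntegral.integral_const_mul, integral_exp_I_mul_int_mul, sub_eq_zero,
    mul_ite, mul_zero, Finset.sum_ite_eq']
  split_ifs
  · field_simp
  · rfl

theorem fourierPartialSum_eq_trigPoly (f : ℝ → ℂ) (n : ℕ) :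
    fourierPartialSum f n = trigPoly (Finset.Icc (-(n : ℤ)) n) (fourierHat f) :=
  rfl

theorem continuous_fourierPartialSum (f : ℝ → ℂ) (n : ℕ) : Continuous (fourierPartialSum f n) :=
  continuous_trigPoly _ _

theorem fourierPartialSum_sub {f g : ℝ → ℂ} (hf : IntervalIntegrable f volume (-π) π)
    (hg : IntervalIntegrable g volume (-π) π) (n : ℕ) (x : ℝ) :
    fourierPartialSum (fun x => f x - g x) n x =
      fourierPartialSum f n x - fourierPartialSum g n x := by
  simp only [fourierPartialSum, fourierHat_sub hf hg, sub_mul, Finset.sum_sub_distrib]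

theorem fourierPartialSum_comp_neg (f : ℝ → ℂ) (n : ℕ) (x : ℝ) :
    fourierPartialSum (fun x => f (-x)) n x = fourierPartialSum f n (-x) :=
  Finset.sum_equiv (Equiv.neg ℤ) (by simp [and_comm, neg_le]) fun k _ => by
    simp [fourierHat_comp_neg]

theorem fourierPartialSum_trigPoly {s : Finset ℤ} {n : ℕ} (hs : s ⊆ Finset.Icc (-(n : ℤ)) n)
    (c : ℤ → ℂ) (x : ℝ) : fourierPartialSum (trigPoly s c) n x = trigPoly s c x := by
  simp only [fourierPartialSum, fourierHat_trigPoly, ite_mul, zero_mul, trigPoly]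
  rw [Finset.sum_ite_mem, Finset.inter_eq_right.2 hs]

theorem fourierHat_sub_fourierPartialSum {f : ℝ → ℂ} (hf : IntervalIntegrable f volume (-π) π)
    (n : ℕ) (k : ℤ) : fourierHat (fun x => f x - fourierPartialSum f n x) k =
      if k ∈ Finset.Icc (-(n : ℤ)) n then 0 else fourierHat f k := by
  rw [fourierHat_sub hf ((continuous_fourierPartialSum f n).intervalIntegrable _ _),
    fourierPartialSum_eq_trigPoly, fourierHat_trigPoly]
  split_ifs
  · exact sub_self _
  · exact sub_zero _

/-- The Dirichlet kernel `∑_{|k| ≤ n} e^{ikx}`. -/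
noncomputable def dirichletKernel (n : ℕ) : ℝ → ℂ :=
  trigPoly (Finset.Icc (-(n : ℤ)) n) 1

theorem continuous_dirichletKernel (n : ℕ) : Continuous (dirichletKernel n) :=
  continuous_trigPoly _ _

theorem dirichletKernel_eq_sum_zpow (n : ℕ) (x : ℝ) :
    dirichletKernel n x = ∑ k ∈ Finset.Icc (-(n : ℤ)) n, exp (I * x) ^ k := by
  simp only [dirichletKernel, trigPoly, Pi.one_apply, one_mul, exp_I_mul_int_mul]

theorem integral_dirichletKernel (n : ℕ) : ∫ x in (-π)..π, dirichletKernel n x = 2 * π := by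
  simp only [dirichletKernel, trigPoly, Pi.one_apply, one_mul]
  rw [intervalIntegral.integral_finsetSum
    fun k _ => Continuous.intervalIntegrable (by fun_prop) _ _]
  simp [integral_exp_I_mul_int_mul]

theorem fourierPartialSum_eq_integral {f : ℝ → ℂ} (hf : IntervalIntegrable f volume (-π) π)
    (n : ℕ) (x : ℝ) :
    fourierPartialSum f n x = (2 * π : ℂ)⁻¹ * ∫ t in (-π)..π, f t * dirichletKernel n (x - t) := by
  simp only [fourierPartialSum, dirichletKernel, trigPoly, fourierHat_eq_integral, Finset.mul_sum]
  rw [intervalIntegral.integral_finsetSum fun k _ => hf.mul_continuousOn (by fun_prop),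
    Finset.mul_sum]
  refine Finset.sum_congr rfl fun k _ => ?_
  rw [mul_assoc, ← intervalIntegral.integral_mul_const]
  congr 1
  refine intervalIntegral.integral_congr fun t _ => ?_
  simp only [mul_assoc, ← Complex.exp_add, Pi.one_apply, one_mul]
  push_cast
  ring_nf

theorem sum_Icc_neg_zpow_eq {K : Type*} [Field K] {z : K} (hz : z ≠ 0) (n : ℕ) :
    ∑ k ∈ Finset.Icc (-(n : ℤ)) n, z ^ k = (∑ j ∈ Finset.range n, z ^ j) * z⁻¹ ^ n +
      (∑ j ∈ Finset.range n, z⁻¹ ^ j) * z ^ n + 1 := by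
  induction n with
  | zero => simp
  | succ n ih =>
    rw [sum_Icc_neg_eq_add_sum_Ico _ n.le_succ, ih, Nat.Ico_succ_singleton, Finset.sum_singleton,
      zpow_neg, ← inv_zpow, zpow_natCast, zpow_natCast, geom_sum_succ, geom_sum_succ]
    linear_combination (-((∑ j ∈ Finset.range n, z ^ j) * z⁻¹ ^ n +
      (∑ j ∈ Finset.range n, z⁻¹ ^ j) * z ^ n)) * mul_inv_cancel₀ hz

theorem sum_sum_Icc_neg_zpow_eq {K : Type*} [Field K] {z : K} (hz : z ≠ 0) (N : ℕ) :
    ∑ l ∈ Finset.range N, ∑ k ∈ Finset.Icc (-(l : ℤ)) l, z ^ k =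
      (∑ j ∈ Finset.range N, z ^ j) * ∑ j ∈ Finset.range N, z⁻¹ ^ j := by
  induction N with
  | zero => simp
  | succ N ih =>
    have hzN : z ^ N * z⁻¹ ^ N = 1 := by rw [← mul_pow, mul_inv_cancel₀ hz, one_pow]
    rw [Finset.sum_range_succ, ih, sum_Icc_neg_zpow_eq hz, Finset.sum_range_succ,
      Finset.sum_range_succ]
    linear_combination -hzN

/-- The Fejér kernel without its normalising factor `1 / N`, so that it is the sum, rather than the
mean, of the first `N` Dirichlet kernels. -/
noncomputable def fejerKernel (N : ℕ) (x : ℝ) : ℝ :=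
  ‖∑ j ∈ Finset.range N, exp (I * x) ^ j‖ ^ 2

theorem fejerKernel_nonneg (N : ℕ) (x : ℝ) : 0 ≤ fejerKernel N x :=
  sq_nonneg _

theorem ofReal_fejerKernel (N : ℕ) (x : ℝ) :
    (fejerKernel N x : ℂ) = ∑ l ∈ Finset.range N, dirichletKernel l x := by
  have hconj : conj (exp (I * x)) = (exp (I * x))⁻¹ := by
    rw [← Complex.exp_conj, ← Complex.exp_neg, map_mul, Complex.conj_I, Complex.conj_ofReal,
      neg_mul]
  simp only [dirichletKernel_eq_sum_zpow]
  rw [sum_sum_Icc_neg_zpow_eq (Complex.exp_ne_zero _), fejerKernel, Complex.ofReal_pow,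
    ← Complex.mul_conj', map_sum]
  simp only [map_pow, hconj]

theorem l1Norm_fejerKernel (N : ℕ) : l1Norm (fun x => (fejerKernel N x : ℂ)) = 2 * π * N := by
  have hint : ((∫ x in (-π)..π, fejerKernel N x : ℝ) : ℂ) = 2 * π * N := by
    rw [← intervalIntegral.integral_ofReal]
    simp only [ofReal_fejerKernel]
    rw [intervalIntegral.integral_finsetSum
      fun l _ => (continuous_dirichletKernel l).intervalIntegrable _ _]
    simp [integral_dirichletKernel, mul_comm]
  simp only [l1Norm, Complex.norm_real, Real.norm_of_nonneg (fejerKernel_nonneg N _)]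
  exact_mod_cast hint

theorem sum_fourierPartialSum_eq_integral {f : ℝ → ℂ} (hf : IntervalIntegrable f volume (-π) π)
    (N : ℕ) (x : ℝ) :
    ∑ l ∈ Finset.range N, fourierPartialSum f l x =
      (2 * π : ℂ)⁻¹ * ∫ t in (-π)..π, f t * fejerKernel N (x - t) := by
  simp only [fourierPartialSum_eq_integral hf, ofReal_fejerKernel, Finset.mul_sum]
  rw [intervalIntegral.integral_finsetSum, Finset.mul_sum]
  exact fun l _ => hf.mul_continuousOn
    ((continuous_dirichletKernel l).comp (continuous_const.sub continuous_id)).continuousOn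

theorem l1Norm_sum_fourierPartialSum_le {f : ℝ → ℂ} (hf : IntervalIntegrable f volume (-π) π)
    (N : ℕ) :
    l1Norm (fun x => ∑ l ∈ Finset.range N, fourierPartialSum f l x) ≤ N * l1Norm f := by
  have hcont : Continuous fun x => (fejerKernel N x : ℂ) := by
    unfold fejerKernel
    fun_prop
  have hper : Function.Periodic (fun x => (fejerKernel N x : ℂ)) (2 * π) := fun x => by
    simp only [ofReal_fejerKernel]
    exact Finset.sum_congr rfl fun l _ => periodic_trigPoly _ _ x
  have hyoung := l1Norm_integral_mul_comp_sub_le hf hcont hper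
  rw [l1Norm_fejerKernel] at hyoung
  simp only [sum_fourierPartialSum_eq_integral hf, l1Norm_const_mul]
  calc ‖(2 * π : ℂ)⁻¹‖ * l1Norm (fun x => ∫ t in (-π)..π, f t * fejerKernel N (x - t))
      ≤ ‖(2 * π : ℂ)⁻¹‖ * (l1Norm f * (2 * π * N)) := by gcongr
    _ = N * l1Norm f := by
        rw [norm_inv, norm_mul, Complex.norm_two, Complex.norm_real,
          Real.norm_of_nonneg Real.pi_pos.le]
        field_simp

theorem fourier_two_pi_coe (k : ℤ) (x : ℝ) :
    fourier k (x : AddCircle (2 * π)) = exp (I * k * x) := by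
  have : (π : ℂ) ≠ 0 := by exact_mod_cast Real.pi_ne_zero
  rw [fourier_coe_apply]
  congr 1
  push_cast
  field_simp

theorem exists_eq_trigPoly_of_mem_span_fourier {P : C(AddCircle (2 * π), ℂ)}
    (hP : P ∈ Submodule.span ℂ (Set.range fourier)) :
    ∃ (s : Finset ℤ) (c : ℤ → ℂ), ∀ x : ℝ, P x = trigPoly s c x := by
  obtain ⟨a, rfl⟩ := Finsupp.mem_span_range_iff_exists_finsupp.1 hP
  refine ⟨a.support, a, fun x => ?_⟩
  simp only [Finsupp.sum, ContinuousMap.sum_apply, ContinuousMap.smul_apply, smul_eq_mul,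
    fourier_two_pi_coe, trigPoly]

theorem integral_norm_liftIoc_sub_eq [Fact (0 < 2 * π)] (f : ℝ → ℂ) (P : AddCircle (2 * π) → ℂ) :
    ∫ t, ‖AddCircle.liftIoc (2 * π) (-π) f t - P t‖ ∂AddCircle.haarAddCircle =
      (2 * π)⁻¹ * l1Norm (fun x => f x - P x) := by
  have hπ : -π + 2 * π = π := by ring
  rw [AddCircle.integral_haarAddCircle, smul_eq_mul,
    ← AddCircle.intervalIntegral_preimage (2 * π) (-π), hπ, l1Norm]
  congr 1
  refine intervalIntegral.integral_congr_ae (.of_forall fun x hx => ?_)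
  rw [Set.uIoc_of_le (by linarith [Real.pi_pos])] at hx
  rw [AddCircle.liftIoc_coe_apply (by rwa [hπ])]

theorem exists_mem_span_fourier_integral_norm_sub_lt {T : ℝ} [Fact (0 < T)] {F : AddCircle T → ℂ}
    (hF : MemLp F 1 AddCircle.haarAddCircle) {ε : ℝ} (hε : 0 < ε) :
    ∃ P ∈ Submodule.span ℂ (Set.range (fourier (T := T))),
      ∫ t, ‖F t - P t‖ ∂AddCircle.haarAddCircle < ε := by
  set L := ContinuousMap.toLp (E := ℂ) 1 (AddCircle.haarAddCircle (T := T)) ℂ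
  have hmem : hF.toLp F ∈
      (Submodule.span ℂ (Set.range (fourierLp (T := T) 1))).topologicalClosure := by
    rw [span_fourierLp_closure_eq_top ENNReal.one_ne_top]
    exact Submodule.mem_top
  obtain ⟨u, hu, hlt⟩ := Metric.mem_closure_iff.1 hmem ε hε
  obtain ⟨P, hP, rfl⟩ : ∃ P ∈ Submodule.span ℂ (Set.range (fourier (T := T))), L P = u := by
    have hrange : Set.range (fourierLp (T := T) 1) = L.toLinearMap '' Set.range fourier := by
      rw [← Set.range_comp]
      rfl
    rwa [hrange, ← Submodule.map_span] at hu
  refine ⟨P, hP, lt_of_eq_of_lt ?_ hlt⟩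
  rw [dist_eq_norm, L1.norm_eq_integral_norm]
  refine integral_congr_ae ?_
  filter_upwards [Lp.coeFn_sub (hF.toLp F) (L P), hF.coeFn_toLp,
    ContinuousMap.coeFn_toLp (p := 1) (𝕜 := ℂ) AddCircle.haarAddCircle P] with t hsub hFt hPt
  rw [hsub, Pi.sub_apply, hFt, hPt]

theorem exists_trigPoly_l1Norm_sub_lt {f : ℝ → ℂ} (hf : IntervalIntegrable f volume (-π) π)
    {ε : ℝ} (hε : 0 < ε) :
    ∃ (s : Finset ℤ) (c : ℤ → ℂ), l1Norm (fun x => f x - trigPoly s c x) < ε := by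
  have : Fact (0 < 2 * π) := ⟨Real.two_pi_pos⟩
  have hf' : MemLp f 1 (volume.restrict (Set.Ioc (-π) (-π + 2 * π))) := by
    rw [memLp_one_iff_integrable, show -π + 2 * π = π by ring]
    exact hf.1
  obtain ⟨P, hP, hlt⟩ := exists_mem_span_fourier_integral_norm_sub_lt
    hf'.memLp_liftIoc.haarAddCircle (show 0 < (2 * π)⁻¹ * ε by positivity)
  obtain ⟨s, c, hPsc⟩ := exists_eq_trigPoly_of_mem_span_fourier hP
  rw [integral_norm_liftIoc_sub_eq, mul_lt_mul_iff_right₀ (by positivity)] at hlt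
  simp only [hPsc] at hlt
  exact ⟨s, c, hlt⟩

/-- The de la Vallée Poussin mean `n⁻¹ (S_n f + ⋯ + S_{2n-1} f)`. -/
noncomputable def delayedMean (f : ℝ → ℂ) (n : ℕ) (x : ℝ) : ℂ :=
  (n : ℂ)⁻¹ * ∑ l ∈ Finset.Ico n (2 * n), fourierPartialSum f l x

theorem continuous_delayedMean (f : ℝ → ℂ) (n : ℕ) : Continuous (delayedMean f n) :=
  continuous_const.mul (continuous_finsetSum _ fun l _ => continuous_fourierPartialSum f l)

theorem delayedMean_sub {f g : ℝ → ℂ} (hf : IntervalIntegrable f volume (-π) π)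
    (hg : IntervalIntegrable g volume (-π) π) (n : ℕ) (x : ℝ) :
    delayedMean (fun x => f x - g x) n x = delayedMean f n x - delayedMean g n x := by
  simp only [delayedMean, fourierPartialSum_sub hf hg, Finset.sum_sub_distrib, mul_sub]

theorem inv_mul_sum_Ico_two_mul_const {n : ℕ} (hn : n ≠ 0) (z : ℂ) :
    (n : ℂ)⁻¹ * ∑ _l ∈ Finset.Ico n (2 * n), z = z := by
  rw [Finset.sum_const, Nat.card_Ico, two_mul, Nat.add_sub_cancel, nsmul_eq_mul,
    inv_mul_cancel_left₀ (by exact_mod_cast hn)]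

theorem delayedMean_trigPoly {s : Finset ℤ} {n : ℕ} (hn : n ≠ 0)
    (hs : s ⊆ Finset.Icc (-(n : ℤ)) n) (c : ℤ → ℂ) (x : ℝ) :
    delayedMean (trigPoly s c) n x = trigPoly s c x := by
  have hfix : ∀ l ∈ Finset.Ico n (2 * n),
      fourierPartialSum (trigPoly s c) l x = trigPoly s c x := fun l hl => by
    have hnl : (n : ℤ) ≤ l := by exact_mod_cast (Finset.mem_Ico.1 hl).1
    exact fourierPartialSum_trigPoly
      (hs.trans (Finset.Icc_subset_Icc (neg_le_neg hnl) hnl)) c x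
  rw [delayedMean, Finset.sum_congr rfl hfix, inv_mul_sum_Ico_two_mul_const hn]

theorem l1Norm_delayedMean_le {f : ℝ → ℂ} (hf : IntervalIntegrable f volume (-π) π) {n : ℕ}
    (hn : n ≠ 0) : l1Norm (delayedMean f n) ≤ 3 * l1Norm f := by
  have hn0 : (n : ℝ) ≠ 0 := by exact_mod_cast hn
  have hint (N : ℕ) : IntervalIntegrable
      (fun x => ∑ l ∈ Finset.range N, fourierPartialSum f l x) volume (-π) π :=
    (continuous_finsetSum _ fun l _ => continuous_fourierPartialSum f l).intervalIntegrable _ _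
  have hsplit : delayedMean f n = fun x => (n : ℂ)⁻¹ *
      (∑ l ∈ Finset.range (2 * n), fourierPartialSum f l x -
        ∑ l ∈ Finset.range n, fourierPartialSum f l x) :=
    funext fun x => by rw [delayedMean, Finset.sum_Ico_eq_sub _ (by omega)]
  rw [hsplit, l1Norm_const_mul, norm_inv, Complex.norm_natCast]
  calc (n : ℝ)⁻¹ * _ ≤ (n : ℝ)⁻¹ * ((2 * n : ℕ) * l1Norm f + n * l1Norm f) := by
        gcongr
        exact (l1Norm_sub_le (hint _) (hint _)).trans (add_le_add
          (l1Norm_sum_fourierPartialSum_le hf _) (l1Norm_sum_fourierPartialSum_le hf _))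
    _ = 3 * l1Norm f := by
        push_cast
        field_simp
        ring

theorem tendsto_l1Norm_sub_delayedMean {f : ℝ → ℂ} (hf : IntervalIntegrable f volume (-π) π) :
    Tendsto (fun n => l1Norm (fun x => f x - delayedMean f n x)) atTop (𝓝 0) := by
  refine tendsto_order.2 ⟨fun b hb => .of_forall fun n => hb.trans_le (l1Norm_nonneg _),
    fun ε hε => ?_⟩
  obtain ⟨s, c, hsc⟩ := exists_trigPoly_l1Norm_sub_lt hf (show 0 < ε / 4 by positivity)
  have hP : IntervalIntegrable (trigPoly s c) volume (-π) π :=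
    (continuous_trigPoly s c).intervalIntegrable _ _
  set g : ℝ → ℂ := fun x => f x - trigPoly s c x with hg
  filter_upwards [eventually_ne_atTop 0, Finset.tendsto_Icc_neg.eventually_ge_atTop s]
    with n hn hs
  have hfg (x : ℝ) : f x - delayedMean f n x = g x - delayedMean g n x := by
    rw [hg, delayedMean_sub hf hP, delayedMean_trigPoly hn hs]
    ring
  calc l1Norm (fun x => f x - delayedMean f n x) = l1Norm (fun x => g x - delayedMean g n x) := by
        simp only [hfg]
    _ ≤ l1Norm g + 3 * l1Norm g :=
        (l1Norm_sub_le (hf.sub hP) ((continuous_delayedMean g n).intervalIntegrable _ _)).trans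
          (add_le_add_right (l1Norm_delayedMean_le (hf.sub hP) hn) _)
    _ < ε := by linarith

theorem l1Norm_delayedMean_sub_le {f : ℝ → ℂ} {n : ℕ} (hn : n ≠ 0) {ε : ℝ}
    (h : ∀ l ∈ Finset.Ico n (2 * n),
      l1Norm (fun x => fourierPartialSum f l x - fourierPartialSum f n x) ≤ ε) :
    l1Norm (fun x => delayedMean f n x - fourierPartialSum f n x) ≤ ε := by
  have hn0 : (n : ℝ) ≠ 0 := by exact_mod_cast hn
  have hmean (x : ℝ) : delayedMean f n x - fourierPartialSum f n x = (n : ℂ)⁻¹ *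
      ∑ l ∈ Finset.Ico n (2 * n), (fourierPartialSum f l x - fourierPartialSum f n x) := by
    rw [Finset.sum_sub_distrib, mul_sub, inv_mul_sum_Ico_two_mul_const hn, delayedMean]
  simp only [hmean, l1Norm_const_mul, norm_inv, Complex.norm_natCast]
  calc (n : ℝ)⁻¹ * _ ≤ (n : ℝ)⁻¹ * ∑ _l ∈ Finset.Ico n (2 * n), ε := by
        gcongr
        refine (l1Norm_sum_le _ fun l _ => ?_).trans (Finset.sum_le_sum h)
        exact ((continuous_fourierPartialSum f l).sub
          (continuous_fourierPartialSum f n)).intervalIntegrable _ _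
    _ = ε := by
        rw [Finset.sum_const, Nat.card_Ico, two_mul, Nat.add_sub_cancel, nsmul_eq_mul,
          inv_mul_cancel_left₀ hn0]

theorem fourierPartialSum_sub_fourierPartialSum (f : ℝ → ℂ) {m n : ℕ} (hmn : m ≤ n) (x : ℝ) :
    fourierPartialSum f n x - fourierPartialSum f m x =
      ∑ k ∈ Finset.Ico (m + 1) (n + 1), fourierHat f k * exp (I * x) ^ k +
        ∑ k ∈ Finset.Ico (m + 1) (n + 1), fourierHat f (-k) * exp (I * (-x : ℝ)) ^ k := by
  have hneg (k : ℕ) : exp (I * (-(k : ℤ) : ℤ) * x) = exp (I * (-x : ℝ)) ^ k := by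
    rw [← zpow_natCast, ← exp_I_mul_int_mul]
    push_cast
    ring_nf
  rw [fourierPartialSum, sum_Icc_neg_eq_add_sum_Ico _ hmn, fourierPartialSum, add_sub_cancel_left,
    Finset.sum_add_distrib]
  simp only [hneg, exp_I_mul_int_mul _ x, zpow_natCast]

theorem l1Norm_fourierPartialSum_sub_le (f : ℝ → ℂ) {m n : ℕ} (hmn : m ≤ n) (hn : n ≤ 2 * m) :
    l1Norm (fun x => fourierPartialSum f n x - fourierPartialSum f m x) ≤
      4 * π * Real.log (m + 1) * (bvNorm (fun k : ℕ => fourierHat f k) (m + 1) (n + 1) +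
        bvNorm (fun k : ℕ => fourierHat f (-k)) (m + 1) (n + 1)) := by
  set V := bvNorm (fun k : ℕ => fourierHat f k) (m + 1) (n + 1)
  set W := bvNorm (fun k : ℕ => fourierHat f (-k)) (m + 1) (n + 1)
  have hpointwise : ∀ x ∈ Set.Icc (-π) π,
      ‖fourierPartialSum f n x - fourierPartialSum f m x‖ ≤ (V + W) * geomSumMajorant m x := by
    intro x hx
    have hx : |x| ≤ π := abs_le.2 hx
    rw [fourierPartialSum_sub_fourierPartialSum f hmn, add_mul]
    refine norm_add_le_of_le
      (norm_sum_Ico_mul_le_bvNorm_mul (by omega) fun l hl =>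
        norm_geom_sum_exp_le_geomSumMajorant hx (by omega))
      (norm_sum_Ico_mul_le_bvNorm_mul (by omega) fun l hl => ?_)
    rw [← geomSumMajorant_neg]
    exact norm_geom_sum_exp_le_geomSumMajorant (by rwa [abs_neg]) (by omega)
  calc l1Norm (fun x => fourierPartialSum f n x - fourierPartialSum f m x)
      ≤ ∫ x in (-π)..π, (V + W) * geomSumMajorant m x := by
        refine intervalIntegral.integral_mono_on (by linarith [Real.pi_pos]) ?_ ?_ hpointwise
        · exact ((continuous_fourierPartialSum f n).sub
            (continuous_fourierPartialSum f m)).norm.intervalIntegrable _ _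
        · exact (continuous_const.mul (continuous_geomSumMajorant m)).intervalIntegrable _ _
    _ = 4 * π * Real.log (m + 1) * (V + W) := by
        rw [intervalIntegral.integral_const_mul, integral_geomSumMajorant]
        ring

theorem IsGBV.conj {c : ℕ → ℂ} (hc : IsGBV c) : IsGBV fun n => conj (c n) := by
  obtain ⟨⟨θ, hθ0, hθ, hsec⟩, N, hN, M, hM, hvar⟩ := hc
  refine ⟨⟨θ, hθ0, hθ, fun n hn => ?_⟩, N, hN, M, hM, fun m hm => ?_⟩
  · have harg : |Complex.arg (c n)| ≤ θ := hsec n hn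
    have hne : Complex.arg (c n) ≠ π := by
      have := (le_abs_self _).trans harg
      linarith [Real.pi_pos]
    change |Complex.arg (conj (c n))| ≤ θ
    rwa [Complex.arg_conj, if_neg hne, abs_neg]
  · simpa only [← map_sub, RCLike.norm_conj] using hvar m hm

theorem IsGBV.exists_sum_norm_sub_le {c : ℕ → ℂ} (hc : IsGBV c) :
    ∃ (N : ℕ) (M : ℝ), 0 < M ∧ ∀ m : ℕ, 1 ≤ m → ∃ i ∈ Finset.Ico m (m + N),
      ∑ n ∈ Finset.Icc m (2 * m), ‖c n - c (n + 1)‖ ≤ M * ‖c i‖ := by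
  obtain ⟨-, N, hN, M, hM, hvar⟩ := hc
  refine ⟨N, M, hM, fun m hm => ?_⟩
  obtain ⟨i, hi, hmax⟩ := Finset.exists_mem_eq_sup'
    (Finset.nonempty_Ico.mpr (Nat.lt_add_of_pos_right (n := m) hN)) (fun n => ‖c n‖)
  exact ⟨i, hi, hmax ▸ hvar m hm⟩

theorem IsGBV.eventually_bvNorm_mul_log_le {c : ℕ → ℂ} (hc : IsGBV c)
    (hlog : Tendsto (fun n : ℕ => ‖c n‖ * Real.log n) atTop (𝓝 0)) {ε : ℝ} (hε : 0 < ε) :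
    ∀ᶠ m : ℕ in atTop, ∀ n, m ≤ n → n ≤ 2 * m → bvNorm c m n * Real.log m ≤ ε := by
  obtain ⟨N, M, hM, hvar⟩ := hc.exists_sum_norm_sub_le
  set δ := ε / (1 + M)
  have hlarge : ∀ᶠ m : ℕ in atTop, ∀ k ≥ m, ‖c k‖ * Real.log k ≤ δ :=
    eventually_forall_ge_atTop.2 (hlog.eventually_le_const (by positivity))
  filter_upwards [hlarge, eventually_ge_atTop 1] with m hm hm1 n hmn hn
  obtain ⟨i, hi, hsum⟩ := hvar m hm1
  have hsmall (k : ℕ) (hk : m ≤ k) : ‖c k‖ * Real.log m ≤ δ := by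
    refine le_trans ?_ (hm k hk)
    gcongr
  have hVar : ∑ k ∈ Finset.Ico m n, ‖c k - c (k + 1)‖ ≤ M * ‖c i‖ :=
    (Finset.sum_le_sum_of_subset_of_nonneg
      (Finset.Ico_subset_Icc_self.trans (Finset.Icc_subset_Icc le_rfl hn))
      fun _ _ _ => norm_nonneg _).trans hsum
  calc bvNorm c m n * Real.log m ≤ (‖c n‖ + M * ‖c i‖) * Real.log m := by
        unfold bvNorm
        gcongr
    _ = ‖c n‖ * Real.log m + M * (‖c i‖ * Real.log m) := by ring
    _ ≤ δ + M * δ := by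
        gcongr
        · exact hsmall n hmn
        · exact hsmall i (Finset.mem_Ico.1 hi).1
    _ = ε := by
        rw [← one_add_mul, mul_div_cancel₀]
        positivity

theorem eventually_l1Norm_fourierPartialSum_sub_le {f : ℝ → ℂ}
    (hpos : IsGBV fun n : ℕ => fourierHat f n) (hneg : IsGBV fun n : ℕ => fourierHat f (-n))
    (hlogpos : Tendsto (fun n : ℕ => ‖fourierHat f n‖ * Real.log n) atTop (𝓝 0))
    (hlogneg : Tendsto (fun n : ℕ => ‖fourierHat f (-n)‖ * Real.log n) atTop (𝓝 0))
    {ε : ℝ} (hε : 0 < ε) :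
    ∀ᶠ m : ℕ in atTop, ∀ n ∈ Finset.Ico m (2 * m),
      l1Norm (fun x => fourierPartialSum f n x - fourierPartialSum f m x) ≤ ε := by
  have hδ : 0 < ε / (8 * π) := by positivity
  have hshift := tendsto_add_atTop_nat 1
  filter_upwards [hshift.eventually (hpos.eventually_bvNorm_mul_log_le hlogpos hδ),
    hshift.eventually (hneg.eventually_bvNorm_mul_log_le hlogneg hδ)] with m hmpos hmneg n hn
  rw [Finset.mem_Ico] at hn
  have hV := hmpos (n + 1) (by omega) (by omega)
  have hW := hmneg (n + 1) (by omega) (by omega)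
  push_cast at hV hW
  calc l1Norm (fun x => fourierPartialSum f n x - fourierPartialSum f m x)
      ≤ 4 * π * Real.log (m + 1) * (bvNorm (fun k : ℕ => fourierHat f k) (m + 1) (n + 1) +
          bvNorm (fun k : ℕ => fourierHat f (-k)) (m + 1) (n + 1)) :=
        l1Norm_fourierPartialSum_sub_le f hn.1 hn.2.le
    _ = 4 * π * (bvNorm (fun k : ℕ => fourierHat f k) (m + 1) (n + 1) * Real.log (m + 1) +
          bvNorm (fun k : ℕ => fourierHat f (-k)) (m + 1) (n + 1) * Real.log (m + 1)) := by ring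
    _ ≤ 4 * π * (ε / (8 * π) + ε / (8 * π)) := by gcongr
    _ = ε := by
        field_simp
        ring

theorem tendsto_l1Norm_of_tendsto_mul_log {f : ℝ → ℂ} (hf : IntervalIntegrable f volume (-π) π)
    (hpos : IsGBV fun n : ℕ => fourierHat f n) (hneg : IsGBV fun n : ℕ => fourierHat f (-n))
    (hlogpos : Tendsto (fun n : ℕ => ‖fourierHat f n‖ * Real.log n) atTop (𝓝 0))
    (hlogneg : Tendsto (fun n : ℕ => ‖fourierHat f (-n)‖ * Real.log n) atTop (𝓝 0)) :
    Tendsto (fun n => l1Norm (fun x => f x - fourierPartialSum f n x)) atTop (𝓝 0) := by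
  refine tendsto_order.2 ⟨fun b hb => .of_forall fun n => hb.trans_le (l1Norm_nonneg _),
    fun ε hε => ?_⟩
  have hδ : 0 < ε / 2 := by positivity
  filter_upwards [eventually_ne_atTop 0,
    (tendsto_l1Norm_sub_delayedMean hf).eventually_lt_const hδ,
    eventually_l1Norm_fourierPartialSum_sub_le hpos hneg hlogpos hlogneg hδ] with n hn hmean hblock
  have hV : IntervalIntegrable (delayedMean f n) volume (-π) π :=
    (continuous_delayedMean f n).intervalIntegrable _ _
  have hS : IntervalIntegrable (fourierPartialSum f n) volume (-π) π :=
    (continuous_fourierPartialSum f n).intervalIntegrable _ _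
  calc l1Norm (fun x => f x - fourierPartialSum f n x)
      = l1Norm (fun x => (f x - delayedMean f n x) +
          (delayedMean f n x - fourierPartialSum f n x)) := by simp only [sub_add_sub_cancel]
    _ ≤ l1Norm (fun x => f x - delayedMean f n x) +
          l1Norm (fun x => delayedMean f n x - fourierPartialSum f n x) :=
        l1Norm_add_le (hf.sub hV) (hV.sub hS)
    _ < ε := by linarith [l1Norm_delayedMean_sub_le hn hblock]

theorem fourierHat_sub_fourierHat_neg {g : ℝ → ℂ} (hg : IntervalIntegrable g volume (-π) π)
    (k : ℤ) :
    fourierHat g k - fourierHat g (-k) =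
      -(I / π) * ∫ t in (-π)..π, g t * (Real.sin (k * t) : ℂ) := by
  have hsin (t : ℝ) : g t * exp (-(I * k * t)) - g t * exp (-(I * (-k : ℤ) * t)) =
      -2 * I * (g t * (Real.sin (k * t) : ℂ)) := by
    have hneg : -(I * k * t) = -(k * t) * I := by ring
    have hpos : -(I * (-k : ℤ) * t) = k * t * I := by
      push_cast
      ring
    rw [hneg, hpos]
    push_cast
    rw [Complex.sin]
    linear_combination (g t * (exp (-(k * t) * I) - exp (k * t * I))) * Complex.I_sq
  rw [fourierHat_eq_integral, fourierHat_eq_integral, ← mul_sub,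
    ← intervalIntegral.integral_sub (hg.mul_continuousOn (by fun_prop))
      (hg.mul_continuousOn (by fun_prop))]
  simp only [hsin, intervalIntegral.integral_const_mul]
  ring

theorem norm_sum_fourierHat_sub_fourierHat_neg_div_le {g : ℝ → ℂ}
    (hg : IntervalIntegrable g volume (-π) π) (n : ℕ) :
    ‖∑ j ∈ Finset.Ico 1 (n + 1), (fourierHat g j - fourierHat g (-j)) / j‖ ≤
      (1 + π) / π * l1Norm g := by
  have hpair : ∑ j ∈ Finset.Ico 1 (n + 1), (fourierHat g j - fourierHat g (-j)) / j =
      -(I / π) * ∫ t in (-π)..π,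
        g t * ((∑ j ∈ Finset.Ico 1 (n + 1), Real.sin (j * t) / j : ℝ) : ℂ) := by
    simp only [fourierHat_sub_fourierHat_neg hg, mul_div_assoc, ← Finset.mul_sum,
      ← intervalIntegral.integral_div]
    rw [← intervalIntegral.integral_finsetSum fun j _ => hg.mul_continuousOn
      (Continuous.div_const (by fun_prop) _).continuousOn]
    simp [Finset.mul_sum]
  have hnorm : ‖-(I / π : ℂ)‖ = π⁻¹ := by
    rw [norm_neg, norm_div, Complex.norm_I, Complex.norm_real, Real.norm_of_nonneg Real.pi_pos.le,
      one_div]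
  rw [hpair, norm_mul, hnorm]
  calc π⁻¹ * _ ≤ π⁻¹ * ((1 + π) * l1Norm g) := by
        gcongr
        rw [l1Norm, ← intervalIntegral.integral_const_mul]
        refine intervalIntegral.norm_integral_le_of_norm_le (by linarith [Real.pi_pos])
          (.of_forall fun t ht => ?_) (hg.norm.const_mul _)
        rw [norm_mul, Complex.norm_real, Real.norm_eq_abs, mul_comm]
        gcongr
        exact abs_sum_sin_div_le (abs_le.2 ⟨ht.1.le, ht.2⟩) n
    _ = (1 + π) / π * l1Norm g := by ring

theorem cos_mul_norm_le_re_of_mem_sector {θ : ℝ} (hθ : θ ≤ π) {z : ℂ} (hz : z ∈ sector θ) :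
    Real.cos θ * ‖z‖ ≤ z.re := by
  have hz : |Complex.arg z| ≤ θ := hz
  rw [← Complex.norm_mul_cos_arg, mul_comm, ← Real.cos_abs (Complex.arg z)]
  gcongr
  exact Real.cos_le_cos_of_nonneg_of_le_pi (abs_nonneg _) hθ hz

theorem norm_sum_fourierHat_add_div_le {f : ℝ → ℂ} (hf : IntervalIntegrable f volume (-π) π)
    (n : ℕ) :
    ‖∑ j ∈ Finset.Ico 1 (n + 1), fourierHat f (n + j : ℕ) / j‖ ≤
      (1 + π) / π * l1Norm (fun x => f x - fourierPartialSum f n x) := by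
  set g : ℝ → ℂ := fun x => (f x - fourierPartialSum f n x) * exp (-(I * (n : ℤ) * x)) with hg
  have hgi : IntervalIntegrable g volume (-π) π :=
    (hf.sub ((continuous_fourierPartialSum f n).intervalIntegrable _ _)).mul_continuousOn
      (by fun_prop)
  have hnorm : l1Norm g = l1Norm (fun x => f x - fourierPartialSum f n x) := by
    simp [l1Norm, hg, Complex.norm_exp]
  have hcoeff : ∀ j ∈ Finset.Ico 1 (n + 1),
      fourierHat f (n + j : ℕ) / j = (fourierHat g j - fourierHat g (-j)) / j := by
    intro j hj
    rw [Finset.mem_Ico] at hj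
    rw [hg, fourierHat_mul_exp, fourierHat_mul_exp, fourierHat_sub_fourierPartialSum hf,
      fourierHat_sub_fourierPartialSum hf, if_neg (by rw [Finset.mem_Icc]; omega),
      if_pos (by rw [Finset.mem_Icc]; omega), sub_zero, Nat.cast_add]
  rw [Finset.sum_congr rfl hcoeff, ← hnorm]
  exact norm_sum_fourierHat_sub_fourierHat_neg_div_le hgi n

theorem cos_mul_sum_norm_fourierHat_div_le {f : ℝ → ℂ} (hf : IntervalIntegrable f volume (-π) π)
    {θ : ℝ} (hθ : θ ≤ π) (hsec : ∀ n : ℕ, 1 ≤ n → fourierHat f n ∈ sector θ) (n : ℕ) :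
    Real.cos θ * ∑ j ∈ Finset.Ico 1 (n + 1), ‖fourierHat f (n + j : ℕ)‖ / j ≤
      (1 + π) / π * l1Norm (fun x => f x - fourierPartialSum f n x) := by
  refine le_trans ?_ ((Complex.re_le_norm _).trans (norm_sum_fourierHat_add_div_le hf n))
  rw [Complex.re_sum, Finset.mul_sum]
  refine Finset.sum_le_sum fun j hj => ?_
  have hj : 1 ≤ n + j := le_add_left (Finset.mem_Ico.1 hj).1
  rw [Complex.div_natCast_re, ← mul_div_assoc]
  gcongr
  exact cos_mul_norm_le_re_of_mem_sector hθ (hsec _ hj)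

theorem IsGBV.exists_norm_le_mul_sum {c : ℕ → ℂ} (hc : IsGBV c) :
    ∃ (N : ℕ) (M : ℝ), 0 < M ∧ ∀ m k : ℕ, 1 ≤ m → m ≤ k → k ≤ 2 * m + 1 →
      ‖c k‖ ≤ M * ∑ i ∈ Finset.range N, ‖c (m + i)‖ := by
  obtain ⟨N, M, hM, hvar⟩ := hc.exists_sum_norm_sub_le
  refine ⟨N, 1 + M, by positivity, fun m k hm hmk hk => ?_⟩
  obtain ⟨i, hi, hsum⟩ := hvar m hm
  rw [Finset.mem_Ico] at hi
  have hterm {l : ℕ} (hml : m ≤ l) (hl : l < m + N) :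
      ‖c l‖ ≤ ∑ i ∈ Finset.range N, ‖c (m + i)‖ := by
    obtain ⟨d, rfl⟩ := Nat.exists_eq_add_of_le hml
    exact Finset.single_le_sum (f := fun i => ‖c (m + i)‖) (fun _ _ => norm_nonneg _)
      (Finset.mem_range.2 (by omega))
  calc ‖c k‖ ≤ ‖c m‖ + ‖c m - c k‖ := by
        rw [norm_sub_rev]
        exact norm_le_norm_add_norm_sub' _ _
    _ ≤ ‖c m‖ + ∑ n ∈ Finset.Ico m k, ‖c n - c (n + 1)‖ := by
        simpa only [dist_eq_norm, add_le_add_iff_left] using dist_le_Ico_sum_dist c hmk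
    _ ≤ ‖c m‖ + ∑ n ∈ Finset.Icc m (2 * m), ‖c n - c (n + 1)‖ := by
        refine add_le_add_right (Finset.sum_le_sum_of_subset_of_nonneg (fun n hn => ?_)
          fun _ _ _ => norm_nonneg _) _
        rw [Finset.mem_Ico] at hn
        exact Finset.mem_Icc.2 (by omega)
    _ ≤ ‖c m‖ + M * ‖c i‖ := by gcongr
    _ ≤ (1 + M) * ∑ i ∈ Finset.range N, ‖c (m + i)‖ := by
        rw [add_mul, one_mul]
        gcongr
        · exact hterm le_rfl (by omega)
        · exact hterm hi.1 hi.2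

theorem log_succ_le_sum_inv (J : ℕ) :
    Real.log (J + 1 : ℕ) ≤ ∑ j ∈ Finset.Ico 1 (J + 1), (j : ℝ)⁻¹ := by
  have h := log_add_one_le_harmonic J
  rw [harmonic_eq_sum_Icc] at h
  push_cast at h ⊢
  exact h

theorem IsGBV.exists_norm_mul_log_le {c : ℕ → ℂ} (hc : IsGBV c) :
    ∃ C : ℝ, 0 ≤ C ∧ ∀ᶠ p : ℕ in atTop,
      ‖c p‖ * Real.log p ≤ C * ∑ l ∈ Finset.Ico 1 (p / 2 + 1), ‖c (p / 2 + l)‖ / l := by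
  obtain ⟨N, M, hM, hspread⟩ := hc.exists_norm_le_mul_sum
  refine ⟨2 * (M * N ^ 2), by positivity, ?_⟩
  filter_upwards [eventually_ge_atTop (4 * N + 8)] with p hp
  obtain ⟨J, hJ⟩ : ∃ J, p / 2 = J + N := ⟨p / 2 - N, by omega⟩
  have hlog : Real.log p ≤ 2 * Real.log (J + 1 : ℕ) := by
    have hsq : p ≤ (J + 1) ^ 2 := by nlinarith [(by omega : p ≤ 4 * J + 1), (by omega : 2 ≤ J)]
    rw [← Nat.cast_ofNat, ← Real.log_pow]
    exact Real.log_le_log (by exact_mod_cast (by omega : 0 < p)) (by exact_mod_cast hsq)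
  have hweighted : ‖c p‖ * ∑ j ∈ Finset.Ico 1 (J + 1), (j : ℝ)⁻¹ ≤
      M * (N ^ 2 * ∑ l ∈ Finset.Ico 1 (p / 2 + 1), ‖c (p / 2 + l)‖ / l) := by
    calc ‖c p‖ * ∑ j ∈ Finset.Ico 1 (J + 1), (j : ℝ)⁻¹
        ≤ M * ∑ j ∈ Finset.Ico 1 (J + 1), (∑ i ∈ Finset.range N, ‖c (p / 2 + (j + i))‖) / j := by
          rw [Finset.mul_sum, Finset.mul_sum]
          refine Finset.sum_le_sum fun j hj => ?_
          rw [Finset.mem_Ico] at hj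
          rw [← mul_div_assoc, ← div_eq_mul_inv]
          simp only [← add_assoc]
          gcongr
          exact hspread (p / 2 + j) p (by omega) (by omega) (by omega)
      _ ≤ M * (N ^ 2 * ∑ l ∈ Finset.Ico 1 (J + N), ‖c (p / 2 + l)‖ / l) := by
          gcongr
          exact sum_sum_add_div_le (a := fun l => ‖c (p / 2 + l)‖) (fun _ => norm_nonneg _) N J
      _ ≤ M * (N ^ 2 * ∑ l ∈ Finset.Ico 1 (p / 2 + 1), ‖c (p / 2 + l)‖ / l) := by
          refine mul_le_mul_of_nonneg_left (mul_le_mul_of_nonneg_left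
            (Finset.sum_le_sum_of_subset_of_nonneg (Finset.Ico_subset_Ico le_rfl (by omega))
              fun _ _ _ => by positivity) (by positivity)) hM.le
  calc ‖c p‖ * Real.log p
      ≤ ‖c p‖ * (2 * ∑ j ∈ Finset.Ico 1 (J + 1), (j : ℝ)⁻¹) := by
        gcongr
        linarith [log_succ_le_sum_inv J]
    _ ≤ 2 * (M * N ^ 2) * ∑ l ∈ Finset.Ico 1 (p / 2 + 1), ‖c (p / 2 + l)‖ / l := by linarith

theorem tendsto_mul_log_of_tendsto_l1Norm {f : ℝ → ℂ} (hf : IntervalIntegrable f volume (-π) π)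
    (hpos : IsGBV fun n : ℕ => fourierHat f n)
    (hlim : Tendsto (fun n => l1Norm (fun x => f x - fourierPartialSum f n x)) atTop (𝓝 0)) :
    Tendsto (fun n : ℕ => ‖fourierHat f n‖ * Real.log n) atTop (𝓝 0) := by
  obtain ⟨C, hC, hlog⟩ := hpos.exists_norm_mul_log_le
  obtain ⟨⟨θ, hθ0, hθ, hsec⟩, -⟩ := hpos
  have hcos : 0 < Real.cos θ := Real.cos_pos_of_mem_Ioo ⟨by linarith, hθ⟩
  have hbound := (hlim.comp (Nat.tendsto_div_const_atTop two_ne_zero)).const_mul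
    (C * ((1 + π) / π / Real.cos θ))
  rw [mul_zero] at hbound
  refine squeeze_zero' (.of_forall fun p => by positivity) ?_ hbound
  filter_upwards [hlog] with p hp
  refine hp.trans ?_
  rw [mul_assoc]
  refine mul_le_mul_of_nonneg_left ?_ hC
  rw [div_mul_eq_mul_div, le_div_iff₀ hcos, mul_comm]
  exact cos_mul_sum_norm_fourierHat_div_le hf (by linarith) hsec (p / 2)

theorem l1Norm_comp_neg_sub_fourierPartialSum (f : ℝ → ℂ) (n : ℕ) :
    l1Norm (fun x => f (-x) - fourierPartialSum (fun x => f (-x)) n x) =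
      l1Norm (fun x => f x - fourierPartialSum f n x) := by
  simp only [fourierPartialSum_comp_neg]
  exact l1Norm_comp_neg fun x => f x - fourierPartialSum f n x

theorem tendsto_neg_mul_log_of_tendsto_l1Norm {f : ℝ → ℂ}
    (hf : IntervalIntegrable f volume (-π) π) (hneg : IsGBV fun n : ℕ => fourierHat f (-n))
    (hlim : Tendsto (fun n => l1Norm (fun x => f x - fourierPartialSum f n x)) atTop (𝓝 0)) :
    Tendsto (fun n : ℕ => ‖fourierHat f (-n)‖ * Real.log n) atTop (𝓝 0) := by
  have hfneg : IntervalIntegrable (fun x => f (-x)) volume (-π) π := by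
    simpa only [neg_neg] using (IntervalIntegrable.iff_comp_neg (f := f)).1 hf |>.symm
  simp only [← l1Norm_comp_neg_sub_fourierPartialSum f, ← fourierHat_comp_neg f] at hlim hneg ⊢
  exact tendsto_mul_log_of_tendsto_l1Norm hfneg hneg hlim

theorem tendsto_cofinite_int_iff {α : Type*} {u : ℤ → α} {l : Filter α} :
    Tendsto u cofinite l ↔
      Tendsto (fun n : ℕ => u n) atTop l ∧ Tendsto (fun n : ℕ => u (-n)) atTop l := by
  rw [Int.cofinite_eq, tendsto_sup, and_comm, ← Nat.map_cast_int_atTop, tendsto_map'_iff,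
    ← map_neg_atTop, ← Nat.map_cast_int_atTop, tendsto_map'_iff, tendsto_map'_iff]
  rfl

theorem tendsto_mul_log_natCast_iff {u : ℕ → ℂ} :
    Tendsto (fun n => u n * (Real.log n : ℂ)) atTop (𝓝 0) ↔
      Tendsto (fun n => ‖u n‖ * Real.log n) atTop (𝓝 0) := by
  rw [tendsto_zero_iff_norm_tendsto_zero]
  simp only [norm_mul, Complex.norm_real, Real.norm_of_nonneg (Real.log_natCast_nonneg _)]

theorem tendsto_mul_log_abs_cofinite_iff {c : ℤ → ℂ} :
    Tendsto (fun n : ℤ => c n * (Real.log |(n : ℝ)| : ℂ)) cofinite (𝓝 0) ↔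
      Tendsto (fun n : ℕ => ‖c n‖ * Real.log n) atTop (𝓝 0) ∧
        Tendsto (fun n : ℕ => ‖c (-n)‖ * Real.log n) atTop (𝓝 0) := by
  simp only [tendsto_cofinite_int_iff, Int.cast_neg, abs_neg, Int.cast_natCast, Nat.abs_cast,
    tendsto_mul_log_natCast_iff]

theorem tendsto_fourierHat_ofReal_mul_log_abs_cofinite_iff (f : ℝ → ℝ) :
    Tendsto (fun n : ℤ => fourierHat (fun x => (f x : ℂ)) n * (Real.log |(n : ℝ)| : ℂ))
        cofinite (𝓝 0) ↔
      Tendsto (fun n : ℕ => fourierHat (fun x => (f x : ℂ)) n * (Real.log n : ℂ)) atTop (𝓝 0) := by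
  simp only [tendsto_mul_log_abs_cofinite_iff, tendsto_mul_log_natCast_iff, fourierHat_ofReal_neg,
    RCLike.norm_conj, and_self]

theorem corollary2_general {f : ℝ → ℂ} (hf : IntervalIntegrable f volume (-π) π)
    (hpos : IsGBV fun n : ℕ => fourierHat f n) (hneg : IsGBV fun n : ℕ => fourierHat f (-n)) :
    Tendsto (fun n : ℕ => l1Norm (fun x => f x - fourierPartialSum f n x)) atTop (𝓝 0) ↔
      Tendsto (fun n : ℤ => fourierHat f n * (Real.log |(n : ℝ)| : ℂ)) cofinite (𝓝 0) := by
  rw [tendsto_mul_log_abs_cofinite_iff]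
  exact ⟨fun h => ⟨tendsto_mul_log_of_tendsto_l1Norm hf hpos h,
      tendsto_neg_mul_log_of_tendsto_l1Norm hf hneg h⟩,
    fun h => tendsto_l1Norm_of_tendsto_mul_log hf hpos hneg h.1 h.2⟩

theorem corollary2 (f : ℝ → ℝ) (hf : MemL2pi (fun x => (f x : ℂ)))
    (hGBV : IsGBV (fun n : ℕ => fourierHat (fun x => (f x : ℂ)) (n : ℤ))) :
    (Filter.Tendsto
        (fun n : ℕ => l1Norm (fun x => (f x : ℂ) - fourierPartialSum (fun x => (f x : ℂ)) n x))
        Filter.atTop (nhds 0) ↔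
      Filter.Tendsto
        (fun n : ℕ => fourierHat (fun x => (f x : ℂ)) (n : ℤ) * (Real.log (n : ℝ) : ℂ))
        Filter.atTop (nhds 0)) ∧
    (Filter.Tendsto
        (fun n : ℕ => l1Norm (fun x => (f x : ℂ) - fourierPartialSum (fun x => (f x : ℂ)) n x))
        Filter.atTop (nhds 0) ↔
      Filter.Tendsto
        (fun n : ℤ => fourierHat (fun x => (f x : ℂ)) n * (Real.log |(n : ℝ)| : ℂ))
        Filter.cofinite (nhds 0)) := by
  have h := corollary2_general hf.2 hGBV (by simpa only [fourierHat_ofReal_neg] using hGBV.conj)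
  exact ⟨h.trans (tendsto_fourierHat_ofReal_mul_log_abs_cofinite_iff f), h⟩
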